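/- There are numerical constants $c_0\in(0,1)$ and $K>0$ such that the following holds. Write points of $\mathbb{R}^{n}\times\mathbb{R}^{m}$ as $z=(x,y)$, with the Euclidean norm $\|\cdot\|_2$; for matrices, $\|\cdot\|_2$ is the spectral norm. Let $f$ be a real-valued, twice continuously differentiable function on a neighbourhood $D$ of $z^*=(x^*,y^*)$ in $\mathbb{R}^n\times\mathbb{R}^m$, and write $$\nabla^2 f(z^*)=\begin{pmatrix} C & B\\ B^\top & -A\end{pmatrix},\qquad C\in\mathbb{R}^{n\times n},\ B\in\mathbb{R}^{n\times m},\ A\in\mathbb{R}^{m\times m}.$$ Suppose that $z^*$ is a differential Stackelberg equilibrium of $f$ with parameters $(L,\mu,\mu_x)$, that is: $\nabla_x f(z^*)=0$, $\nabla_y f(z^*)=0$, $A$ and $C+BA^{-1}B^\top$ are positive definite, $\max\{\|A\|_2,\|B\|_2,\|C\|_2\}\le L$, $\mu=\lambda_{\min}(A)$ and $\mu_x=\min\{L,\lambda_{\min}(C+BA^{-1}B^\top)\}$. Put $\kappa=L/\mu$ and $\kappa_x=L/\mu_x$. Let $r\ge 2\kappa$, $\eta_x=\frac{1}{4rL}$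 and $\eta_y=\frac1{4L}$. Suppose that $$M=\begin{pmatrix}-C&-B\\ rB^\top&-rA\end{pmatrix}$$ is diagonalizable over $\mathbb{C}$, $M=P^{-1}\Lambda P$ with $P$ invertible and $\Lambda$ diagonal, and put $C_P=\|P\|_2\|P^{-1}\|_2$. Then there is $\delta>0$ such that for every $z^0$ with $\|z^0-z^*\|_2\le\delta$ the iterates $z^k=(x^k,y^k)$ of each of the following two methods are well defined (all points where the gradient is evaluated lie in the interior of $D$): - gradient descent ascent (GDA): $x^{k+1}=x^k-\eta_x\nabla_xf(z^k)$, $y^{k+1}=y^k+\eta_y\nabla_yf(z^k)$; - extra-gradient (EG): $x^{k+1/2}=x^k-\eta_x\nabla_xf(z^k)$, $y^{k+1/2}=y^k+\eta_y\nabla_yf(z^k)$, and then $x^{k+1}=x^k-\eta_x\nabla_xf(z^{k+1/2})$, $y^{k+1}=y^k+\eta_y\nabla_yf(z^{k+1/2})$; and they satisfy $$\|z^T-z^*\|_2\le C_P\,\|z^0-z^*\|_2\left(1-\frac{c_0}{r\kappa_x}\right)^T\qquad\text{for all } T\ge 0.$$ Consequently, for every $\varepsilon>0$, either method reaches, and keeps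 at all later iterations, an error $\|z^T-z^*\|_2<\varepsilon$ after at most $$K\max\left\{1,\; r\kappa_x\log\left(\frac{C_P\|z^0-z^*\|_2}{\varepsilon}\right)\right\}$$ gradient evaluations (one per iteration of GDA, two per iteration of EG; when $z^0=z^*$ the maximum is read as $1$). That is, the gradient complexity is $\mathcal{O}\left(r\kappa_x\log(C_P\|z^0-z^*\|_2/\varepsilon)\right)$. -/

import Mathlib

open scoped Matrix.Norms.L2Operator Topology

noncomputable section

namespace Minimax

/-- The space `ℝⁿ × ℝᵐ` of stacked vectors `z = (x, y)` with the Euclidean norm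
`‖z‖² = ‖x‖² + ‖y‖²`; the coordinates `Sum.inl i` form `x`, the coordinates `Sum.inr j` form `y`. -/
abbrev Point (n m : ℕ) : Type := EuclideanSpace ℝ (Fin n ⊕ Fin m)

variable {n m : ℕ}

/-- The partial gradient `∇ₓ f(z)`. -/
def gradX (f : Point n m → ℝ) (z : Point n m) : EuclideanSpace ℝ (Fin n) :=
  WithLp.toLp 2 fun i => gradient f z (Sum.inl i)

/-- The partial gradient `∇_y f(z)`. -/
def gradY (f : Point n m → ℝ) (z : Point n m) : EuclideanSpace ℝ (Fin m) :=
  WithLp.toLp 2 fun j => gradient f z (Sum.inr j)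

/-- The Hessian matrix `∇² f(z)`: the derivative (Jacobian matrix) of the gradient. -/
def hess (f : Point n m → ℝ) (z : Point n m) : Matrix (Fin n ⊕ Fin m) (Fin n ⊕ Fin m) ℝ :=
  Matrix.of fun i j => fderiv ℝ (gradient f) z (EuclideanSpace.single j 1) i

/-- `C = ∇²ₓₓ f(z)`. -/
def blockC (f : Point n m → ℝ) (z : Point n m) : Matrix (Fin n) (Fin n) ℝ :=
  (hess f z).toBlocks₁₁

/-- `B = ∇²ₓᵧ f(z)`. -/
def blockB (f : Point n m → ℝ) (z : Point n m) : Matrix (Fin n) (Fin m) ℝ :=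
  (hess f z).toBlocks₁₂

/-- `A = -∇²ᵧᵧ f(z)`. -/
def blockA (f : Point n m → ℝ) (z : Point n m) : Matrix (Fin m) (Fin m) ℝ :=
  -(hess f z).toBlocks₂₂

/-- The Schur complement `C + B A⁻¹ Bᵀ`. -/
def schur (f : Point n m → ℝ) (z : Point n m) : Matrix (Fin n) (Fin n) ℝ :=
  blockC f z + blockB f z * (blockA f z)⁻¹ * (blockB f z).transpose

/-- `z` is a differential Stackelberg equilibrium of `f`. -/
structure IsDifferentialStackelberg (f : Point n m → ℝ) (z : Point n m) : Prop where
  gradX_eq_zero : gradX f z = 0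
  gradY_eq_zero : gradY f z = 0
  posDef_A : (blockA f z).PosDef
  posDef_schur : (schur f z).PosDef

/-- `z` is a differential Stackelberg equilibrium of `f` with parameters `(L, μ, μₓ)`:
`max {‖A‖₂, ‖B‖₂, ‖C‖₂} ≤ L` (spectral norms), `μ = λ_min(A)` and
`μₓ = min {L, λ_min(C + B A⁻¹ Bᵀ)}`. -/
structure IsStackelbergWith (f : Point n m → ℝ) (z : Point n m) (L μ μx : ℝ) : Prop where
  stackelberg : IsDifferentialStackelberg f z
  smooth : max ‖blockA f z‖ (max ‖blockB f z‖ ‖blockC f z‖) ≤ L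
  mu_eq : IsLeast (spectrum ℝ (blockA f z)) μ
  mux_eq : ∃ l, IsLeast (spectrum ℝ (schur f z)) l ∧ μx = min L l

/-- The matrix `M = [[-C, -B], [r Bᵀ, -r A]]`. -/
def dynMatrix (f : Point n m → ℝ) (z : Point n m) (r : ℝ) :
    Matrix (Fin n ⊕ Fin m) (Fin n ⊕ Fin m) ℝ :=
  Matrix.fromBlocks (-blockC f z) (-blockB f z)
    (r • (blockB f z).transpose) (-(r • blockA f z))

/-- Starting from `z = (x, y)`, one descent step in `x` and one ascent step in `y` along the
gradient of `f` queried at `w`: `(x - ηx ∇ₓ f(w), y + ηy ∇_y f(w))`. -/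
def stepAlong (f : Point n m → ℝ) (ηx ηy : ℝ) (z w : Point n m) : Point n m :=
  WithLp.toLp 2 (Sum.elim (fun i => z (Sum.inl i) - ηx * gradX f w i)
    (fun j => z (Sum.inr j) + ηy * gradY f w j))

/-- A state of an algorithm: the current iterate and the number of calls made so far to the exact
gradient oracle, where one call returns `(∇ₓ f(w), ∇_y f(w))` at one point `w`. -/
structure RunState (n m : ℕ) where
  point : Point n m
  calls : ℕ

/-- Gradient descent ascent from `z₀`, after `k` iterations. An iteration queries the oracle
once, at the current iterate. -/
def gdaRun (f : Point n m → ℝ) (ηx ηy : ℝ) (z₀ : Point n m) : ℕ → RunState n m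
  | 0 => ⟨z₀, 0⟩
  | k + 1 =>
    let s := gdaRun f ηx ηy z₀ k
    ⟨stepAlong f ηx ηy s.point s.point, s.calls + 1⟩

/-- The intermediate point `z^{k+1/2}` of an extra-gradient iteration from `z = z^k`. -/
def egHalf (f : Point n m → ℝ) (ηx ηy : ℝ) (z : Point n m) : Point n m :=
  stepAlong f ηx ηy z z

/-- The extra-gradient method from `z₀`, after `k` iterations. An iteration queries the oracle
twice, at the current iterate and at the intermediate point. -/
def egRun (f : Point n m → ℝ) (ηx ηy : ℝ) (z₀ : Point n m) : ℕ → RunState n m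
  | 0 => ⟨z₀, 0⟩
  | k + 1 =>
    let s := egRun f ηx ηy z₀ k
    ⟨stepAlong f ηx ηy s.point (egHalf f ηx ηy s.point), s.calls + 2⟩

end Minimax

end

/-!
With `η = ηx` we have `ηy = r η`, so near `zs` one step of gradient descent ascent is
`1 + η M` to first order and one step of the extra-gradient method is `1 + η M (1 + η M)`, where
`M` is the matrix diagonalized by `P`. In the norm `v ↦ ‖P v‖` each of the two contracts at the
rate of its largest eigenvalue, and slightly weakening that rate absorbs the nonlinear remainder;
comparing `‖P v‖` with `‖v‖` costs the factor `‖P‖ ‖P⁻¹‖`.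

It remains to locate the eigenvalues `l` of `M`. If `(x, y)` is an eigenvector, pairing the two
rows `-C x - B y = l x` and `r (Bᵀ x - A y) = l y` with `x` and `y` gives scalar equations whose
real and imaginary parts, together with the Schur complement bound `C + B A⁻¹ Bᵀ ≥ μx` and
`r ≥ 2 L / μ`, confine `l` to `-r L ≤ re l ≤ -μx / 2`, `(im l)² ≤ -2 r L re l`. After scaling by
`η = 1 / (4 r L)`, both `|1 + s|` and `|1 + s (1 + s)|` are at most `1 + re s / 2` on this region.
-/

namespace Minimax

section Saddle

open Complex InnerProductSpace

variable {E F : Type*} [NormedAddCommGroup E] [InnerProductSpace ℂ E]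
  [NormedAddCommGroup F] [InnerProductSpace ℂ F]

/-- The Hessian blocks of a quadratic saddle `½⟪x, C x⟫ + re ⟪x, B y⟫ - ½⟪y, A y⟫`: they are bounded
by `L`, `A ≥ μ`, and the Schur complement is at least `μx`. `B'` is the adjoint of `B`, and `h` in
`le_schur` plays the role of `A⁻¹ B' x`, so that neither adjoints nor inverses need completeness. -/
structure SaddleForm (C : E →ₗ[ℂ] E) (B : F →ₗ[ℂ] E) (B' : E →ₗ[ℂ] F) (A : F →ₗ[ℂ] F)
    (L μ μx : ℝ) : Prop where
  symm_C : C.IsSymmetric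
  symm_A : A.IsSymmetric
  adjoint_B : ∀ x y, ⟪B' x, y⟫_ℂ = ⟪x, B y⟫_ℂ
  norm_C_le : ∀ x, ‖C x‖ ≤ L * ‖x‖
  norm_B_le : ∀ y, ‖B y‖ ≤ L * ‖y‖
  norm_A_le : ∀ y, ‖A y‖ ≤ L * ‖y‖
  le_A : ∀ y, μ * ‖y‖ ^ 2 ≤ re ⟪y, A y⟫_ℂ
  le_schur : ∀ x, ∃ h, A h = B' x ∧ μx * ‖x‖ ^ 2 ≤ re ⟪x, C x⟫_ℂ + re ⟪h, A h⟫_ℂ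
  mu_pos : 0 < μ
  mux_pos : 0 < μx
  mu_le : μ ≤ L
  mux_le : μx ≤ L

/-- `(x, y)` is an eigenvector, with eigenvalue `l`, of the block operator
`[[-C, -B], [r B', -r A]]` that drives descent-ascent with timescale ratio `r`. -/
structure IsFlowEigenvector (C : E →ₗ[ℂ] E) (B : F →ₗ[ℂ] E) (B' : E →ₗ[ℂ] F) (A : F →ₗ[ℂ] F)
    (r : ℝ) (l : ℂ) (x : E) (y : F) : Prop where
  descent : -C x - B y = l • x
  ascent : (r : ℂ) • (B' x - A y) = l • y
  ne_zero : x ≠ 0 ∨ y ≠ 0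

theorem abs_re_inner_apply_le {T : E →ₗ[ℂ] E} {L : ℝ} (hT : ∀ x, ‖T x‖ ≤ L * ‖x‖) (x : E) :
    |re ⟪x, T x⟫_ℂ| ≤ L * ‖x‖ ^ 2 :=
  calc |re ⟪x, T x⟫_ℂ| ≤ ‖x‖ * ‖T x‖ := (abs_re_le_norm _).trans (norm_inner_le_norm _ _)
    _ ≤ ‖x‖ * (L * ‖x‖) := by gcongr; exact hT x
    _ = L * ‖x‖ ^ 2 := by ring

theorem mul_re_inner_apply_le_norm_sq {T : E →ₗ[ℂ] E} {μ : ℝ}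
    (hT : ∀ x, μ * ‖x‖ ^ 2 ≤ re ⟪x, T x⟫_ℂ) (hμ : 0 ≤ μ) (x : E) :
    μ * re ⟪x, T x⟫_ℂ ≤ ‖T x‖ ^ 2 := by
  have hinner : re ⟪x, T x⟫_ℂ ≤ ‖x‖ * ‖T x‖ := (re_le_norm _).trans (norm_inner_le_norm _ _)
  have hcoercive : μ * ‖x‖ ≤ ‖T x‖ := by
    rcases (norm_nonneg x).eq_or_lt' with h0 | h0
    · rw [h0, mul_zero]
      exact norm_nonneg _
    · exact le_of_mul_le_mul_left (by linarith [hT x]) h0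
  calc μ * re ⟪x, T x⟫_ℂ ≤ μ * (‖x‖ * ‖T x‖) := by gcongr
    _ = μ * ‖x‖ * ‖T x‖ := by ring
    _ ≤ ‖T x‖ * ‖T x‖ := by gcongr
    _ = ‖T x‖ ^ 2 := (sq _).symm

namespace SaddleForm

variable {C : E →ₗ[ℂ] E} {B : F →ₗ[ℂ] E} {B' : E →ₗ[ℂ] F} {A : F →ₗ[ℂ] F} {L μ μx r : ℝ}
  {l : ℂ} {x : E} {y : F}

theorem one_le_ratio (S : SaddleForm C B B' A L μ μx) (hr : 2 * L ≤ r * μ) : 1 ≤ r :=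
  le_of_mul_le_mul_right (by linarith [S.mu_pos, S.mu_le]) S.mu_pos

theorem inner_descent (S : SaddleForm C B B' A L μ μx) (e : IsFlowEigenvector C B B' A r l x y) :
    re ⟪x, C x⟫_ℂ + re ⟪x, B y⟫_ℂ = -(l.re * ‖x‖ ^ 2) ∧ im ⟪x, B y⟫_ℂ = -(l.im * ‖x‖ ^ 2) := by
  have h : -⟪x, C x⟫_ℂ - ⟪x, B y⟫_ℂ = l * (‖x‖ ^ 2 : ℝ) := by
    have := congrArg (fun v => ⟪x, v⟫_ℂ) e.descent
    simpa [inner_sub_right, inner_smul_right, inner_self_eq_norm_sq_to_K] using this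
  have hreal : im ⟪x, C x⟫_ℂ = 0 := S.symm_C.im_inner_self_apply x
  have hre := congrArg re h
  have him := congrArg im h
  simp only [sub_re, neg_re, sub_im, neg_im, re_mul_ofReal, im_mul_ofReal, hreal] at hre him
  constructor <;> linarith

theorem inner_ascent (S : SaddleForm C B B' A L μ μx) (e : IsFlowEigenvector C B B' A r l x y) :
    r * (re ⟪x, B y⟫_ℂ - re ⟪y, A y⟫_ℂ) = l.re * ‖y‖ ^ 2 ∧
      r * im ⟪x, B y⟫_ℂ = -(l.im * ‖y‖ ^ 2) := by
  have h : (r : ℂ) * (⟪y, B' x⟫_ℂ - ⟪y, A y⟫_ℂ) = l * (‖y‖ ^ 2 : ℝ) := by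
    have := congrArg (fun v => ⟪y, v⟫_ℂ) e.ascent
    simpa [inner_sub_right, inner_smul_right, inner_self_eq_norm_sq_to_K] using this
  have hreal : im ⟪y, A y⟫_ℂ = 0 := S.symm_A.im_inner_self_apply y
  rw [← inner_conj_symm, S.adjoint_B] at h
  have hre := congrArg re h
  have him := congrArg im h
  simp only [re_ofReal_mul, im_ofReal_mul, sub_re, sub_im, conj_re, conj_im, re_mul_ofReal,
    im_mul_ofReal, hreal] at hre him
  constructor <;> linarith

theorem re_mul_weighted_norm_sq (S : SaddleForm C B B' A L μ μx)
    (e : IsFlowEigenvector C B B' A r l x y) :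
    l.re * (r * ‖x‖ ^ 2 + ‖y‖ ^ 2) = -(r * (re ⟪x, C x⟫_ℂ + re ⟪y, A y⟫_ℂ)) := by
  linear_combination r * (S.inner_descent e).1 - (S.inner_ascent e).1

theorem neg_mul_le_re (S : SaddleForm C B B' A L μ μx) (hr : 1 ≤ r)
    (e : IsFlowEigenvector C B B' A r l x y) : -(r * L) ≤ l.re := by
  have hweight : 0 < r * ‖x‖ ^ 2 + ‖y‖ ^ 2 := by
    rcases e.ne_zero with h | h <;> positivity
  refine le_of_mul_le_mul_right ?_ hweight
  have hrL : 0 ≤ r * L := mul_nonneg (by linarith) (by linarith [S.mu_pos, S.mu_le])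
  calc -(r * L) * (r * ‖x‖ ^ 2 + ‖y‖ ^ 2) ≤ -(r * L) * (1 * ‖x‖ ^ 2 + ‖y‖ ^ 2) :=
        mul_le_mul_of_nonpos_left (by gcongr) (by linarith)
    _ = -(r * (L * ‖x‖ ^ 2 + L * ‖y‖ ^ 2)) := by ring
    _ ≤ -(r * (re ⟪x, C x⟫_ℂ + re ⟪y, A y⟫_ℂ)) := by
        gcongr
        · exact (abs_le.1 (abs_re_inner_apply_le S.norm_C_le x)).2
        · exact (abs_le.1 (abs_re_inner_apply_le S.norm_A_le y)).2
    _ = l.re * (r * ‖x‖ ^ 2 + ‖y‖ ^ 2) := (S.re_mul_weighted_norm_sq e).symm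

theorem norm_sq_eq_of_im_ne_zero (S : SaddleForm C B B' A L μ μx)
    (e : IsFlowEigenvector C B B' A r l x y) (hl : l.im ≠ 0) : ‖y‖ ^ 2 = r * ‖x‖ ^ 2 :=
  mul_left_cancel₀ hl <| by
    linear_combination (S.inner_ascent e).2 - r * (S.inner_descent e).2

theorem norm_sq_pos_of_im_ne_zero (S : SaddleForm C B B' A L μ μx)
    (e : IsFlowEigenvector C B B' A r l x y) (hl : l.im ≠ 0) : 0 < ‖x‖ ^ 2 := by
  refine pow_pos (norm_pos_iff.2 fun hx => ?_) 2
  have hy : y = 0 := by simpa [hx] using S.norm_sq_eq_of_im_ne_zero e hl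
  exact e.ne_zero.elim (· hx) (· hy)

theorem re_le_of_im_ne_zero (S : SaddleForm C B B' A L μ μx) (hr : 2 * L ≤ r * μ)
    (e : IsFlowEigenvector C B B' A r l x y) (hl : l.im ≠ 0) : l.re ≤ -(L / 2) := by
  have hr0 : 0 < r := by linarith [S.one_le_ratio hr]
  have hy := S.norm_sq_eq_of_im_ne_zero e hl
  have htrace : 2 * l.re * ‖x‖ ^ 2 = -(re ⟪x, C x⟫_ℂ + re ⟪y, A y⟫_ℂ) :=
    mul_left_cancel₀ hr0.ne' <| by
      linear_combination S.re_mul_weighted_norm_sq e - l.re * hy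
  have hC := (abs_le.1 (abs_re_inner_apply_le S.norm_C_le x)).1
  have hA : 2 * L * ‖x‖ ^ 2 ≤ re ⟪y, A y⟫_ℂ :=
    calc 2 * L * ‖x‖ ^ 2 ≤ r * μ * ‖x‖ ^ 2 := by gcongr
      _ = μ * ‖y‖ ^ 2 := by rw [hy]; ring
      _ ≤ re ⟪y, A y⟫_ℂ := S.le_A y
  refine le_of_mul_le_mul_right ?_ (S.norm_sq_pos_of_im_ne_zero e hl)
  linarith

theorem im_sq_le_of_im_ne_zero (S : SaddleForm C B B' A L μ μx)
    (e : IsFlowEigenvector C B B' A r l x y) (hl : l.im ≠ 0) : l.im ^ 2 ≤ r * L ^ 2 := by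
  have hx := S.norm_sq_pos_of_im_ne_zero e hl
  have hB : |l.im * ‖x‖ ^ 2| ≤ ‖x‖ * (L * ‖y‖) := by
    rw [← abs_neg, ← (S.inner_descent e).2]
    calc |im ⟪x, B y⟫_ℂ| ≤ ‖x‖ * ‖B y‖ := (abs_im_le_norm _).trans (norm_inner_le_norm _ _)
      _ ≤ ‖x‖ * (L * ‖y‖) := by gcongr; exact S.norm_B_le y
  refine le_of_mul_le_mul_right ?_ (pow_pos hx 2)
  calc l.im ^ 2 * (‖x‖ ^ 2) ^ 2 = |l.im * ‖x‖ ^ 2| ^ 2 := by rw [sq_abs, mul_pow]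
    _ ≤ (‖x‖ * (L * ‖y‖)) ^ 2 := by gcongr
    _ = L ^ 2 * ‖x‖ ^ 2 * ‖y‖ ^ 2 := by ring
    _ = r * L ^ 2 * (‖x‖ ^ 2) ^ 2 := by rw [S.norm_sq_eq_of_im_ne_zero e hl]; ring

-- Writing `l = r w`, the ascent equation reads `A (h - y) = w y` for `A h = B' x`, so the Schur
-- bound at `x` is tested against `⟪h, A h⟫ = ⟪y, A y⟫ + 2 w ‖y‖² + ⟪h - y, A (h - y)⟫`.
theorem schur_le_of_real_eigenvalue (S : SaddleForm C B B' A L μ μx) {w : ℝ} (hr : r ≠ 0)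
    (e : IsFlowEigenvector C B B' A r (r * w : ℝ) x y) :
    μ * ((μx + r * w) * ‖x‖ ^ 2) ≤ w * ((μ + w) * ‖y‖ ^ 2) := by
  obtain ⟨h, hh, hschur⟩ := S.le_schur x
  set g := h - y
  have hg : A g = (w : ℂ) • y := by
    have := e.ascent
    rw [ofReal_mul, mul_smul] at this
    rw [map_sub, hh]
    exact smul_right_injective F (ofReal_ne_zero.2 hr) this
  have hAg : μ * re ⟪g, A g⟫_ℂ ≤ w ^ 2 * ‖y‖ ^ 2 := by
    refine (mul_re_inner_apply_le_norm_sq S.le_A S.mu_pos.le g).trans_eq ?_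
    rw [hg, norm_smul, norm_real, mul_pow, Real.norm_eq_abs, sq_abs]
  have hyg : re ⟪y, A g⟫_ℂ = w * ‖y‖ ^ 2 := by
    rw [hg, inner_smul_right, re_ofReal_mul]
    exact congrArg (w * ·) (inner_self_eq_norm_sq (𝕜 := ℂ) y)
  have hgy : re ⟪g, A y⟫_ℂ = w * ‖y‖ ^ 2 := by
    rw [← S.symm_A, ← inner_conj_symm, conj_re, hyg]
  have hAh : re ⟪h, A h⟫_ℂ = re ⟪y, A y⟫_ℂ + 2 * (w * ‖y‖ ^ 2) + re ⟪g, A g⟫_ℂ := by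
    rw [show h = y + g from (add_sub_cancel y h).symm, map_add, inner_add_left, inner_add_right,
      inner_add_right, add_re, add_re, add_re, hyg, hgy]
    ring
  have hdescent := (S.inner_descent e).1
  have hascent : re ⟪x, B y⟫_ℂ - re ⟪y, A y⟫_ℂ = w * ‖y‖ ^ 2 :=
    mul_left_cancel₀ hr <| by rw [(S.inner_ascent e).1, ofReal_re, mul_assoc]
  rw [ofReal_re] at hdescent
  have hsum : (μx + r * w) * ‖x‖ ^ 2 ≤ w * ‖y‖ ^ 2 + re ⟪g, A g⟫_ℂ := by linarith
  have := mul_le_mul_of_nonneg_left hsum S.mu_pos.le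
  linarith

theorem ascent_norm_sq_le_of_real_eigenvalue (S : SaddleForm C B B' A L μ μx) {w : ℝ} (hr : r ≠ 0)
    (e : IsFlowEigenvector C B B' A r (r * w : ℝ) x y) :
    (μ + w) * ‖y‖ ^ 2 ≤ (L - r * w) * ‖x‖ ^ 2 := by
  have hdescent := (S.inner_descent e).1
  have hascent : re ⟪x, B y⟫_ℂ - re ⟪y, A y⟫_ℂ = w * ‖y‖ ^ 2 :=
    mul_left_cancel₀ hr <| by rw [(S.inner_ascent e).1, ofReal_re, mul_assoc]
  rw [ofReal_re] at hdescent
  linarith [S.le_A y, (abs_le.1 (abs_re_inner_apply_le S.norm_C_le x)).1]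

theorem le_of_real_eigenvalue (S : SaddleForm C B B' A L μ μx) (hr : 2 * L ≤ r * μ) {w : ℝ}
    (e : IsFlowEigenvector C B B' A r (r * w : ℝ) x y) : r * w ≤ -μx := by
  by_contra! hlt
  have hr0 : 0 < r := by linarith [S.one_le_ratio hr]
  have hμw : 0 < μ + w := by
    refine pos_of_mul_pos_right (a := r) ?_ hr0.le
    linarith [S.mux_pos, S.mux_le]
  have hy := S.ascent_norm_sq_le_of_real_eigenvalue hr0.ne' e
  have hx : 0 < ‖x‖ ^ 2 := by
    refine pow_pos (norm_pos_iff.2 fun hx => ?_) 2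
    have hy0 : y ≠ 0 := e.ne_zero.resolve_left (not_not.2 hx)
    have : 0 < (μ + w) * ‖y‖ ^ 2 := by positivity
    simp only [hx, norm_zero, ne_eq, OfNat.ofNat_ne_zero, not_false_eq_true, zero_pow,
      mul_zero] at hy
    linarith
  have hμx : 0 < μ * ((μx + r * w) * ‖x‖ ^ 2) :=
    mul_pos S.mu_pos (mul_pos (by linarith) hx)
  have hschur := S.schur_le_of_real_eigenvalue hr0.ne' e
  rcases lt_or_ge w 0 with hw | hw
  · have : w * ((μ + w) * ‖y‖ ^ 2) ≤ 0 :=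
      mul_nonpos_of_nonpos_of_nonneg hw.le (mul_nonneg hμw.le (sq_nonneg _))
    linarith
  · have hbound : w * ((μ + w) * ‖y‖ ^ 2) ≤ μ * (r * w * ‖x‖ ^ 2) := by
      calc w * ((μ + w) * ‖y‖ ^ 2) ≤ w * ((L - r * w) * ‖x‖ ^ 2) := by gcongr
        _ ≤ w * (r * μ * ‖x‖ ^ 2) := by
            gcongr
            linarith [S.mu_pos, S.mu_le, mul_nonneg hr0.le hw]
        _ = μ * (r * w * ‖x‖ ^ 2) := by ring
    have : 0 < μ * (μx * ‖x‖ ^ 2) := mul_pos S.mu_pos (mul_pos S.mux_pos hx)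
    linarith

theorem eigenvalue_bounds (S : SaddleForm C B B' A L μ μx) (hr : 2 * L ≤ r * μ)
    (e : IsFlowEigenvector C B B' A r l x y) :
    l.re ≤ -(μx / 2) ∧ -(r * L) ≤ l.re ∧ l.im ^ 2 ≤ 2 * r * L * -l.re := by
  have hr1 := S.one_le_ratio hr
  have hL : 0 < L := S.mux_pos.trans_le S.mux_le
  suffices h : l.re ≤ -(μx / 2) ∧ l.im ^ 2 ≤ 2 * r * L * -l.re from
    ⟨h.1, S.neg_mul_le_re hr1 e, h.2⟩
  by_cases hl : l.im = 0
  · have hlw : l = (r * (l.re / r) : ℝ) := by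
      rw [mul_div_cancel₀ _ (by linarith)]
      exact Complex.ext rfl hl
    have hre : l.re ≤ -μx := by
      have := S.le_of_real_eigenvalue hr (hlw ▸ e)
      rwa [mul_div_cancel₀ _ (by linarith)] at this
    have hneg : 0 ≤ -l.re := by linarith [S.mux_pos]
    refine ⟨by linarith [S.mux_pos], ?_⟩
    rw [hl, zero_pow two_ne_zero]
    positivity
  · have hre := S.re_le_of_im_ne_zero hr e hl
    refine ⟨by linarith [S.mux_le], (S.im_sq_le_of_im_ne_zero e hl).trans ?_⟩
    calc r * L ^ 2 = 2 * r * L * (L / 2) := by ring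
      _ ≤ 2 * r * L * -l.re := by gcongr; linarith

end SaddleForm

end Saddle

open Matrix

section Complexification

open InnerProductSpace

/-- The entrywise real part of a complex vector. Together with `imPart` it reduces estimates for the
complexification of a real matrix to the real matrix itself. -/
def rePart {ι : Type*} (x : EuclideanSpace ℂ ι) : EuclideanSpace ℝ ι :=
  WithLp.toLp 2 fun i => (x i).re

/-- The entrywise imaginary part of a complex vector. -/
def imPart {ι : Type*} (x : EuclideanSpace ℂ ι) : EuclideanSpace ℝ ι :=
  WithLp.toLp 2 fun i => (x i).im

variable {ι κ ν : Type*}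

theorem conjTranspose_map_ofReal (M : Matrix ι κ ℝ) :
    (M.map Complex.ofReal)ᴴ = Mᵀ.map Complex.ofReal := by
  ext i j
  simp

theorem map_ofReal_mul [Fintype ι] (M : Matrix ν ι ℝ) (N : Matrix ι κ ℝ) :
    (M * N).map Complex.ofReal = M.map Complex.ofReal * N.map Complex.ofReal :=
  Matrix.map_mul (f := Complex.ofRealHom)

variable [Fintype κ]

theorem re_inner_eq_add (x y : EuclideanSpace ℂ κ) :
    (⟪x, y⟫_ℂ).re = ⟪rePart x, rePart y⟫_ℝ + ⟪imPart x, imPart y⟫_ℝ := by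
  simp only [PiLp.inner_apply, RCLike.inner_apply, Complex.re_sum, Complex.mul_re,
    Complex.conj_re, Complex.conj_im, conj_trivial, rePart, imPart, ← Finset.sum_add_distrib]
  exact Finset.sum_congr rfl fun i _ => by ring

theorem norm_sq_eq_rePart_add_imPart (x : EuclideanSpace ℂ κ) :
    ‖x‖ ^ 2 = ‖rePart x‖ ^ 2 + ‖imPart x‖ ^ 2 := by
  rw [← real_inner_self_eq_norm_sq (rePart x), ← real_inner_self_eq_norm_sq (imPart x),
    ← re_inner_eq_add]
  exact (inner_self_eq_norm_sq (𝕜 := ℂ) x).symm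

variable [DecidableEq κ]

theorem rePart_toEuclideanLin_map (M : Matrix ι κ ℝ) (x : EuclideanSpace ℂ κ) :
    rePart (toEuclideanLin (M.map Complex.ofReal) x) = toEuclideanLin M (rePart x) := by
  ext i
  simp [rePart, toLpLin_apply, mulVec, dotProduct]

theorem imPart_toEuclideanLin_map (M : Matrix ι κ ℝ) (x : EuclideanSpace ℂ κ) :
    imPart (toEuclideanLin (M.map Complex.ofReal) x) = toEuclideanLin M (imPart x) := by
  ext i
  simp [imPart, toLpLin_apply, mulVec, dotProduct]

theorem norm_toEuclideanLin_map_le [Fintype ι] (M : Matrix ι κ ℝ) (x : EuclideanSpace ℂ κ) :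
    ‖toEuclideanLin (M.map Complex.ofReal) x‖ ≤ ‖M‖ * ‖x‖ := by
  refine le_of_sq_le_sq ?_ (by positivity)
  rw [norm_sq_eq_rePart_add_imPart, rePart_toEuclideanLin_map, imPart_toEuclideanLin_map]
  have hM (u : EuclideanSpace ℝ κ) : ‖toEuclideanLin M u‖ ^ 2 ≤ (‖M‖ * ‖u‖) ^ 2 :=
    pow_le_pow_left₀ (norm_nonneg _) (M.l2_opNorm_mulVec u) 2
  calc ‖toEuclideanLin M (rePart x)‖ ^ 2 + ‖toEuclideanLin M (imPart x)‖ ^ 2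
      ≤ (‖M‖ * ‖rePart x‖) ^ 2 + (‖M‖ * ‖imPart x‖) ^ 2 := add_le_add (hM _) (hM _)
    _ = (‖M‖ * ‖x‖) ^ 2 := by
        rw [mul_pow, mul_pow, mul_pow, norm_sq_eq_rePart_add_imPart x, mul_add]

theorem inner_toEuclideanLin_map_transpose [Fintype ι] [DecidableEq ι] (M : Matrix ι κ ℝ)
    (x : EuclideanSpace ℂ ι) (y : EuclideanSpace ℂ κ) :
    ⟪toEuclideanLin (Mᵀ.map Complex.ofReal) x, y⟫_ℂ
      = ⟪x, toEuclideanLin (M.map Complex.ofReal) y⟫_ℂ := by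
  rw [← conjTranspose_map_ofReal, toEuclideanLin_conjTranspose_eq_adjoint,
    LinearMap.adjoint_inner_left]

theorem toEuclideanLin_map_mul_apply [Fintype ι] [DecidableEq ι] (M : Matrix ν ι ℝ)
    (N : Matrix ι κ ℝ) (x : EuclideanSpace ℂ κ) :
    toEuclideanLin ((M * N).map Complex.ofReal) x
      = toEuclideanLin (M.map Complex.ofReal) (toEuclideanLin (N.map Complex.ofReal) x) := by
  rw [map_ofReal_mul]
  ext i
  simp [toLpLin_apply]

theorem norm_le_norm_of_mem_spectrum {𝕜 : Type*} [RCLike 𝕜] {A : Matrix κ κ 𝕜}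
    {μ : 𝕜} (hμ : μ ∈ spectrum 𝕜 A) : ‖μ‖ ≤ ‖A‖ := by
  rcases isEmpty_or_nonempty κ
  · simp [spectrum.of_subsingleton] at hμ
  · exact spectrum.norm_le_norm_of_mem hμ

theorem posSemidef_sub_algebraMap {A : Matrix κ κ ℝ} (hA : A.IsHermitian) {μ : ℝ}
    (hμ : μ ∈ lowerBounds (spectrum ℝ A)) : (A - algebraMap ℝ _ μ).PosSemidef := by
  rw [posSemidef_iff_isHermitian_and_spectrum_nonneg]
  refine ⟨hA.sub ?_, fun a ha => ?_⟩
  · rw [IsHermitian, Algebra.algebraMap_eq_smul_one, conjTranspose_smul, conjTranspose_one,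
      star_trivial]
  · rw [← spectrum.sub_singleton_eq] at ha
    obtain ⟨c, hc, d, rfl, rfl⟩ := ha
    exact sub_nonneg.2 (hμ hc)

theorem mul_norm_sq_le_inner_toEuclideanLin {A : Matrix κ κ ℝ} (hA : A.IsHermitian) {μ : ℝ}
    (hμ : μ ∈ lowerBounds (spectrum ℝ A)) (x : EuclideanSpace ℝ κ) :
    μ * ‖x‖ ^ 2 ≤ ⟪x, toEuclideanLin A x⟫_ℝ := by
  have h : 0 ≤ ⟪x, toEuclideanLin (A - algebraMap ℝ _ μ) x⟫_ℝ :=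
    (isPositive_toEuclideanLin_iff.2 (posSemidef_sub_algebraMap hA hμ)).re_inner_nonneg_right x
  have hsub : toEuclideanLin (A - algebraMap ℝ _ μ) x = toEuclideanLin A x - μ • x := by
    ext i
    simp [Algebra.algebraMap_eq_smul_one, toLpLin_apply]
  rw [hsub, inner_sub_right, inner_smul_right, real_inner_self_eq_norm_sq] at h
  linarith

theorem mul_norm_sq_le_re_inner_toEuclideanLin_map {A : Matrix κ κ ℝ} (hA : A.IsHermitian) {μ : ℝ}
    (hμ : μ ∈ lowerBounds (spectrum ℝ A)) (x : EuclideanSpace ℂ κ) :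
    μ * ‖x‖ ^ 2 ≤ (⟪x, toEuclideanLin (A.map Complex.ofReal) x⟫_ℂ).re := by
  rw [norm_sq_eq_rePart_add_imPart, re_inner_eq_add, rePart_toEuclideanLin_map,
    imPart_toEuclideanLin_map, mul_add]
  exact add_le_add (mul_norm_sq_le_inner_toEuclideanLin hA hμ _)
    (mul_norm_sq_le_inner_toEuclideanLin hA hμ _)

theorem pos_of_mem_spectrum {A : Matrix κ κ ℝ} (hA : A.PosDef) {μ : ℝ} (hμ : μ ∈ spectrum ℝ A) :
    0 < μ := by
  rw [hA.isHermitian.spectrum_real_eq_range_eigenvalues] at hμ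
  obtain ⟨i, rfl⟩ := hμ
  exact hA.eigenvalues_pos i

end Complexification

section BlockMatrix

variable {ι κ : Type*} [Fintype ι] [DecidableEq ι] [Fintype κ] [DecidableEq κ]
  {C : Matrix ι ι ℝ} {B : Matrix ι κ ℝ} {A : Matrix κ κ ℝ}

theorem saddleForm_of_matrix {L μ l : ℝ} (hC : C.IsHermitian) (hA : A.PosDef)
    (hS : (C + B * A⁻¹ * Bᵀ).PosDef) (hCL : ‖C‖ ≤ L) (hBL : ‖B‖ ≤ L) (hAL : ‖A‖ ≤ L)
    (hμ : IsLeast (spectrum ℝ A) μ) (hl : IsLeast (spectrum ℝ (C + B * A⁻¹ * Bᵀ)) l) :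
    SaddleForm (toEuclideanLin (C.map Complex.ofReal)) (toEuclideanLin (B.map Complex.ofReal))
      (toEuclideanLin (Bᵀ.map Complex.ofReal)) (toEuclideanLin (A.map Complex.ofReal))
      L μ (min L l) := by
  have hμ0 := pos_of_mem_spectrum hA hμ.1
  have hμL : μ ≤ L := (le_abs_self μ).trans ((norm_le_norm_of_mem_spectrum hμ.1).trans hAL)
  have hAh : A * (A⁻¹ * Bᵀ) = Bᵀ :=
    mul_nonsing_inv_cancel_left _ _ ((isUnit_iff_isUnit_det A).1 hA.isUnit)
  have hadj (h : EuclideanSpace ℂ κ) (x : EuclideanSpace ℂ ι) :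
      (inner ℂ h (toEuclideanLin (Bᵀ.map Complex.ofReal) x)).re
        = (inner ℂ x (toEuclideanLin (B.map Complex.ofReal) h)).re := by
    rw [← inner_conj_symm, Complex.conj_re, inner_toEuclideanLin_map_transpose]
  refine {
    symm_C := isSymmetric_toEuclideanLin_iff.2 (hC.map _ fun _ => (Complex.conj_ofReal _).symm)
    symm_A := isSymmetric_toEuclideanLin_iff.2
      (hA.isHermitian.map _ fun _ => (Complex.conj_ofReal _).symm)
    adjoint_B := inner_toEuclideanLin_map_transpose B
    norm_C_le := fun x => (norm_toEuclideanLin_map_le C x).trans (by gcongr)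
    norm_B_le := fun y => (norm_toEuclideanLin_map_le B y).trans (by gcongr)
    norm_A_le := fun y => (norm_toEuclideanLin_map_le A y).trans (by gcongr)
    le_A := mul_norm_sq_le_re_inner_toEuclideanLin_map hA.isHermitian hμ.2
    le_schur := fun x => ⟨toEuclideanLin ((A⁻¹ * Bᵀ).map Complex.ofReal) x, ?_, ?_⟩
    mu_pos := hμ0
    mux_pos := lt_min (hμ0.trans_le hμL) (pos_of_mem_spectrum hS hl.1)
    mu_le := hμL
    mux_le := min_le_left _ _ }
  · rw [← toEuclideanLin_map_mul_apply, hAh]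
  · rw [← toEuclideanLin_map_mul_apply, hAh, hadj, ← toEuclideanLin_map_mul_apply, ← Complex.add_re,
      ← inner_add_right, ← LinearMap.add_apply, ← map_add, ← Matrix.map_add _ Complex.ofReal_add,
      ← Matrix.mul_assoc]
    refine le_trans ?_ (mul_norm_sq_le_re_inner_toEuclideanLin_map hS.isHermitian hl.2 x)
    gcongr
    exact min_le_right _ _

theorem isFlowEigenvector_of_fromBlocks {r : ℝ} {l : ℂ} {v : ι ⊕ κ → ℂ} (hv : v ≠ 0)
    (h : (fromBlocks (-C) (-B) (r • Bᵀ) (-(r • A))).map Complex.ofReal *ᵥ v = l • v) :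
    IsFlowEigenvector (toEuclideanLin (C.map Complex.ofReal))
      (toEuclideanLin (B.map Complex.ofReal)) (toEuclideanLin (Bᵀ.map Complex.ofReal))
      (toEuclideanLin (A.map Complex.ofReal)) r l
      (WithLp.toLp 2 (v ∘ Sum.inl)) (WithLp.toLp 2 (v ∘ Sum.inr)) := by
  rw [fromBlocks_map, fromBlocks_mulVec] at h
  refine ⟨?_, ?_, ?_⟩
  · ext i
    have := congrFun h (Sum.inl i)
    simpa [toLpLin_apply, mulVec, dotProduct, sub_eq_add_neg] using this
  · ext i
    have := congrFun h (Sum.inr i)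
    simpa [toLpLin_apply, mulVec, dotProduct, sub_eq_add_neg, mul_add, Finset.mul_sum, mul_assoc]
      using this
  · contrapose! hv
    funext i
    cases i with
    | inl i => exact congrFun (congrArg WithLp.ofLp hv.1) i
    | inr i => exact congrFun (congrArg WithLp.ofLp hv.2) i

end BlockMatrix

section Diagonalization

theorem norm_toLp_ofReal {ι : Type*} [Fintype ι] (v : EuclideanSpace ℝ ι) :
    ‖(WithLp.toLp 2 fun i => (v i : ℂ) : EuclideanSpace ℂ ι)‖ = ‖v‖ := by
  simp [EuclideanSpace.norm_eq]

variable {ι : Type*} [Fintype ι] [DecidableEq ι] {M N : Matrix ι ι ℝ} {P : Matrix ι ι ℂ}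
  {θ φ : ι → ℂ}

theorem toEuclideanCLM_mul_apply {𝕜 : Type*} [RCLike 𝕜] (A B : Matrix ι ι 𝕜)
    (v : EuclideanSpace 𝕜 ι) : toEuclideanCLM (𝕜 := 𝕜) (A * B) v
      = toEuclideanCLM (𝕜 := 𝕜) A (toEuclideanCLM (𝕜 := 𝕜) B v) := by
  rw [map_mul]
  rfl

/-- The invertible complex matrix `P` diagonalizes the real matrix `M`, with eigenvalues `θ`. The
identity `M = P⁻¹ * diagonal θ * P` is written without `P⁻¹`. -/
structure IsDiagonalizedBy (M : Matrix ι ι ℝ) (P : Matrix ι ι ℂ) (θ : ι → ℂ) : Prop where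
  isUnit : IsUnit P
  mul_eq : P * M.map Complex.ofReal = diagonal θ * P

namespace IsDiagonalizedBy

theorem of_eq_conj (hP : IsUnit P) (h : M.map Complex.ofReal = P⁻¹ * diagonal θ * P) :
    IsDiagonalizedBy M P θ where
  isUnit := hP
  mul_eq := by
    rw [h, Matrix.mul_assoc, mul_nonsing_inv_cancel_left _ _ ((isUnit_iff_isUnit_det P).1 hP)]

theorem one_add (h : IsDiagonalizedBy M P θ) : IsDiagonalizedBy (1 + M) P (1 + θ) where
  isUnit := h.isUnit
  mul_eq := by
    have hdiag : diagonal (1 + θ) = 1 + diagonal θ := by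
      rw [← diagonal_one, diagonal_add]
      rfl
    rw [Matrix.map_add _ Complex.ofReal_add, Matrix.map_one _ Complex.ofReal_zero
      Complex.ofReal_one, hdiag, mul_add, add_mul, h.mul_eq, mul_one, one_mul]

theorem mul (hM : IsDiagonalizedBy M P θ) (hN : IsDiagonalizedBy N P φ) :
    IsDiagonalizedBy (M * N) P (θ * φ) where
  isUnit := hM.isUnit
  mul_eq := by
    rw [map_ofReal_mul, ← Matrix.mul_assoc, hM.mul_eq, Matrix.mul_assoc, hN.mul_eq,
      ← Matrix.mul_assoc, diagonal_mul_diagonal]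
    rfl

theorem smul (h : IsDiagonalizedBy M P θ) (η : ℝ) :
    IsDiagonalizedBy (η • M) P ((η : ℂ) • θ) where
  isUnit := h.isUnit
  mul_eq := by
    have : (η • M).map Complex.ofReal = (η : ℂ) • M.map Complex.ofReal := by
      ext i j
      simp
    rw [this, diagonal_smul, Matrix.mul_smul, h.mul_eq, Matrix.smul_mul]

theorem exists_eigenvector (h : IsDiagonalizedBy M P θ) (i : ι) :
    ∃ v ≠ 0, M.map Complex.ofReal *ᵥ v = θ i • v := by
  have hdet : IsUnit P.det := (isUnit_iff_isUnit_det P).1 h.isUnit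
  obtain ⟨v, hv⟩ : ∃ v, P *ᵥ v = Pi.single i 1 :=
    ⟨P⁻¹ *ᵥ Pi.single i 1, by rw [mulVec_mulVec, mul_nonsing_inv _ hdet, one_mulVec]⟩
  refine ⟨v, ?_, mulVec_injective_of_isUnit h.isUnit ?_⟩
  · rintro rfl
    simpa using congrFun hv i
  · simp only [mulVec_mulVec, h.mul_eq, mulVec_smul]
    rw [← mulVec_mulVec, hv, diagonal_mulVec_single, mul_one, ← Pi.single_smul, smul_eq_mul,
      mul_one]

end IsDiagonalizedBy

/-- The coordinates `P v` of a real vector in the eigenbasis of a matrix diagonalized by `P`; in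
the norm `v ↦ ‖P v‖` such a matrix contracts at the rate of its largest eigenvalue. -/
noncomputable def eigenCoord (P : Matrix ι ι ℂ) : EuclideanSpace ℝ ι →+ EuclideanSpace ℂ ι where
  toFun v := toEuclideanCLM (𝕜 := ℂ) P (WithLp.toLp 2 fun i => (v i : ℂ))
  map_zero' := by
    rw [← map_zero (toEuclideanCLM (𝕜 := ℂ) P)]
    congr 1
  map_add' u v := by
    rw [← map_add]
    congr 1
    ext i
    simp

theorem eigenCoord_apply (P : Matrix ι ι ℂ) (v : EuclideanSpace ℝ ι) :
    eigenCoord P v = toEuclideanCLM (𝕜 := ℂ) P (WithLp.toLp 2 fun i => (v i : ℂ)) := rfl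

theorem norm_eigenCoord_le (P : Matrix ι ι ℂ) (v : EuclideanSpace ℝ ι) :
    ‖eigenCoord P v‖ ≤ ‖P‖ * ‖v‖ := by
  rw [← norm_toLp_ofReal v]
  exact (toEuclideanCLM (𝕜 := ℂ) P).le_opNorm _

theorem norm_le_norm_eigenCoord (hP : IsUnit P) (v : EuclideanSpace ℝ ι) :
    ‖v‖ ≤ ‖P⁻¹‖ * ‖eigenCoord P v‖ := by
  have h : toEuclideanCLM (𝕜 := ℂ) P⁻¹ (eigenCoord P v) = WithLp.toLp 2 fun i => (v i : ℂ) := by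
    rw [eigenCoord_apply, ← toEuclideanCLM_mul_apply,
      nonsing_inv_mul _ ((isUnit_iff_isUnit_det P).1 hP), map_one, one_apply_eq_self]
  rw [← norm_toLp_ofReal v, ← h]
  exact (toEuclideanCLM (𝕜 := ℂ) P⁻¹).le_opNorm _

theorem IsDiagonalizedBy.eigenCoord_toEuclideanCLM (h : IsDiagonalizedBy M P θ)
    (v : EuclideanSpace ℝ ι) : eigenCoord P (toEuclideanCLM (𝕜 := ℝ) M v)
      = toEuclideanCLM (𝕜 := ℂ) (diagonal θ) (eigenCoord P v) := by
  have hcomplex : (WithLp.toLp 2 fun i => (toEuclideanCLM (𝕜 := ℝ) M v i : ℂ))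
      = toEuclideanCLM (𝕜 := ℂ) (M.map Complex.ofReal) (WithLp.toLp 2 fun i => (v i : ℂ)) := by
    ext i
    simp [ofLp_toEuclideanCLM, mulVec, dotProduct]
  rw [eigenCoord_apply, eigenCoord_apply, hcomplex, ← toEuclideanCLM_mul_apply, h.mul_eq,
    toEuclideanCLM_mul_apply]

theorem IsDiagonalizedBy.norm_eigenCoord_toEuclideanCLM_le (h : IsDiagonalizedBy M P θ) {ρ : ℝ}
    (hρ : 0 ≤ ρ) (hθ : ∀ i, ‖θ i‖ ≤ ρ) (v : EuclideanSpace ℝ ι) :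
    ‖eigenCoord P (toEuclideanCLM (𝕜 := ℝ) M v)‖ ≤ ρ * ‖eigenCoord P v‖ := by
  rw [h.eigenCoord_toEuclideanCLM]
  refine ((toEuclideanCLM (𝕜 := ℂ) (diagonal θ)).le_opNorm _).trans ?_
  gcongr
  rw [l2_opNorm_toEuclideanCLM, l2_opNorm_diagonal]
  exact (pi_norm_le_iff_of_nonneg hρ).2 hθ

end Diagonalization

section LocalConvergence

open Asymptotics

variable {E W : Type*} [NormedAddCommGroup E] [NormedAddCommGroup W]
  {Φ : E → E} {zs : E} {a b ρ₀ ρ : ℝ}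

theorem eventually_norm_sub_le [NormedSpace ℝ E] {J : E →L[ℝ] E} {N : E →+ W} (hfix : Φ zs = zs)
    (hΦ : HasFDerivAt Φ J zs) (hNa : ∀ v, ‖N v‖ ≤ a * ‖v‖) (hNb : ∀ v, ‖v‖ ≤ b * ‖N v‖)
    (hJ : ∀ v, ‖N (J v)‖ ≤ ρ₀ * ‖N v‖) (hρ : ρ₀ < ρ) :
    ∀ᶠ z in 𝓝 zs, ‖N (Φ z - zs)‖ ≤ ρ * ‖N (z - zs)‖ := by
  have herror : (fun z => N (Φ z - zs - J (z - zs))) =o[𝓝 zs] fun z => N (z - zs) := by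
    have hlin := hΦ.isLittleO
    rw [hfix] at hlin
    exact ((IsBigO.of_bound a (.of_forall fun _ => hNa _)).trans_isLittleO hlin).trans_isBigO
      (IsBigO.of_bound b (.of_forall fun _ => hNb _))
  filter_upwards [herror.def (sub_pos.2 hρ)] with z hz
  calc ‖N (Φ z - zs)‖ = ‖N (J (z - zs)) + N (Φ z - zs - J (z - zs))‖ := by
        rw [← map_add, add_sub_cancel]
    _ ≤ ρ₀ * ‖N (z - zs)‖ + (ρ - ρ₀) * ‖N (z - zs)‖ := norm_add_le_of_le (hJ _) hz
    _ = ρ * ‖N (z - zs)‖ := by ring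

theorem exists_forall_iterate_mem_and_norm_le {N : E → W} (ha : 0 ≤ a) (hb : 0 ≤ b)
    (hNa : ∀ v, ‖N v‖ ≤ a * ‖v‖) (hNb : ∀ v, ‖v‖ ≤ b * ‖N v‖) (hρ : 0 ≤ ρ) (hρ1 : ρ ≤ 1)
    (hΦ : ∀ᶠ z in 𝓝 zs, ‖N (Φ z - zs)‖ ≤ ρ * ‖N (z - zs)‖) {U : Set E} (hU : U ∈ 𝓝 zs) :
    ∃ δ > 0, ∀ z₀, ‖z₀ - zs‖ ≤ δ → ∀ T : ℕ,
      Φ^[T] z₀ ∈ U ∧ ‖Φ^[T] z₀ - zs‖ ≤ a * b * ‖z₀ - zs‖ * ρ ^ T := by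
  obtain ⟨R, hR, hball⟩ := Metric.mem_nhds_iff.1 (Filter.inter_mem hU hΦ)
  refine ⟨R / (a * b + 1), by positivity, fun z₀ hz₀ => ?_⟩
  have hbound {T : ℕ} (h : ‖N (Φ^[T] z₀ - zs)‖ ≤ ρ ^ T * ‖N (z₀ - zs)‖) :
      ‖Φ^[T] z₀ - zs‖ ≤ a * b * ‖z₀ - zs‖ * ρ ^ T :=
    calc ‖Φ^[T] z₀ - zs‖ ≤ b * (ρ ^ T * (a * ‖z₀ - zs‖)) := by
          refine (hNb _).trans ?_
          gcongr
          exact h.trans (by gcongr; exact hNa _)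
      _ = a * b * ‖z₀ - zs‖ * ρ ^ T := by ring
  have hmem {T : ℕ} (h : ‖N (Φ^[T] z₀ - zs)‖ ≤ ρ ^ T * ‖N (z₀ - zs)‖) :
      Φ^[T] z₀ ∈ Metric.ball zs R := by
    rw [mem_ball_iff_norm]
    calc ‖Φ^[T] z₀ - zs‖ ≤ a * b * ‖z₀ - zs‖ * ρ ^ T := hbound h
      _ ≤ a * b * (R / (a * b + 1)) * 1 := by gcongr; exact pow_le_one₀ hρ hρ1
      _ < R := by
        have : 0 ≤ a * b := by positivity
        rw [mul_one, ← mul_div_assoc, div_lt_iff₀ (by positivity)]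
        linarith
  have hcontract (T : ℕ) : ‖N (Φ^[T] z₀ - zs)‖ ≤ ρ ^ T * ‖N (z₀ - zs)‖ := by
    induction T with
    | zero => simp
    | succ T ih =>
      rw [Function.iterate_succ_apply', pow_succ', mul_assoc]
      exact ((hball (hmem ih)).2).trans (by gcongr)
  exact fun T => ⟨(hball (hmem (hcontract T))).1, hbound (hcontract T)⟩

-- Ostrowski's theorem with an explicit constant: the norm `v ↦ ‖P v‖` is equivalent to `‖v‖` with
-- distortion `‖P‖ * ‖P⁻¹‖`, and in it the linearization contracts at rate `ρ₀`.
theorem exists_iterate_norm_le_of_isDiagonalizedBy {ι : Type*} [Fintype ι] [DecidableEq ι]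
    {Φ : EuclideanSpace ℝ ι → EuclideanSpace ℝ ι} {zs : EuclideanSpace ℝ ι} {M : Matrix ι ι ℝ}
    {P : Matrix ι ι ℂ} {θ : ι → ℂ} (hfix : Φ zs = zs)
    (hΦ : HasFDerivAt Φ (toEuclideanCLM (𝕜 := ℝ) M) zs) (hM : IsDiagonalizedBy M P θ)
    (hρ₀ : 0 ≤ ρ₀) (hθ : ∀ i, ‖θ i‖ ≤ ρ₀) (hρ : ρ₀ < ρ) (hρ1 : ρ ≤ 1)
    {U : Set (EuclideanSpace ℝ ι)} (hU : U ∈ 𝓝 zs) :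
    ∃ δ > 0, ∀ z₀, ‖z₀ - zs‖ ≤ δ → ∀ T : ℕ,
      Φ^[T] z₀ ∈ U ∧ ‖Φ^[T] z₀ - zs‖ ≤ ‖P‖ * ‖P⁻¹‖ * ‖z₀ - zs‖ * ρ ^ T :=
  exists_forall_iterate_mem_and_norm_le (norm_nonneg _) (norm_nonneg _) (norm_eigenCoord_le P)
    (norm_le_norm_eigenCoord hM.isUnit) (hρ₀.trans hρ.le) hρ1
    (eventually_norm_sub_le hfix hΦ (norm_eigenCoord_le P) (norm_le_norm_eigenCoord hM.isUnit)
      (hM.norm_eigenCoord_toEuclideanCLM_le hρ₀ hθ) hρ) hU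

end LocalConvergence

section Complexity

variable {n m : ℕ}

/-- The errors of the run `s` with respect to `zs` decay linearly, at most as `d * (1 - c / q) ^ T`,
and stay below any `ε > 0` after `K * max 1 (q * log (d / ε))` oracle calls. For `d = 0` the junk
value `log 0 = 0` makes the maximum equal to `1`. -/
def HasLinearComplexity (s : ℕ → RunState n m) (zs : Point n m) (d c K q : ℝ) : Prop :=
  (∀ T : ℕ, ‖(s T).point - zs‖ ≤ d * (1 - c / q) ^ T) ∧
    ∀ ε : ℝ, 0 < ε → ∃ T : ℕ, ((s T).calls : ℝ) ≤ K * max 1 (q * Real.log (d / ε)) ∧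
      ∀ T' : ℕ, T ≤ T' → ‖(s T').point - zs‖ < ε

theorem mul_one_sub_pow_lt {d x ε : ℝ} {T : ℕ} (hx : x ≤ 1) (hε : 0 < ε)
    (h : Real.log (d / ε) < T * x) : d * (1 - x) ^ T < ε := by
  have hpow : 0 ≤ (1 - x) ^ T := pow_nonneg (by linarith) T
  obtain hd | hd := le_or_gt d 0
  · exact (mul_nonpos_of_nonpos_of_nonneg hd hpow).trans_lt hε
  · calc d * (1 - x) ^ T ≤ d * Real.exp (-x) ^ T := by
          gcongr
          exact Real.one_sub_le_exp_neg x
      _ = d * Real.exp (-(T * x)) := by rw [← Real.exp_nat_mul, mul_neg]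
      _ < d * Real.exp (-Real.log (d / ε)) := by gcongr
      _ = ε := by
          rw [Real.exp_neg, Real.exp_log (by positivity)]
          field_simp

theorem hasLinearComplexity_of_norm_le {s : ℕ → RunState n m} {zs : Point n m} {a : ℕ}
    {d c K q : ℝ} (hc : 0 < c) (hcq : c ≤ q) (hK : a * (1 / c + 1) ≤ K)
    (hcalls : ∀ T, (s T).calls = a * T)
    (hs : ∀ T : ℕ, ‖(s T).point - zs‖ ≤ d * (1 - c / q) ^ T) :
    HasLinearComplexity s zs d c K q := by
  have hq : 0 < q := hc.trans_le hcq
  refine ⟨hs, fun ε hε => ?_⟩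
  set X := max 1 (q * Real.log (d / ε))
  have hX : 1 ≤ X := le_max_left _ _
  have : 0 ≤ X := zero_le_one.trans hX
  refine ⟨⌊X / c⌋₊ + 1, ?_, fun T hT => (hs T).trans_lt (mul_one_sub_pow_lt ?_ hε ?_)⟩
  · have hfloor : (⌊X / c⌋₊ : ℝ) ≤ X / c := Nat.floor_le (by positivity)
    calc ((s (⌊X / c⌋₊ + 1)).calls : ℝ) = a * (⌊X / c⌋₊ + 1) := by
          rw [hcalls]
          push_cast
          rfl
      _ ≤ a * (X / c + X) := by gcongr
      _ = a * (1 / c + 1) * X := by ring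
      _ ≤ K * X := by gcongr
  · exact (div_le_one hq).2 hcq
  · have hT' : X / c < T := (Nat.lt_floor_add_one _).trans_le (by exact_mod_cast hT)
    calc Real.log (d / ε) = q * Real.log (d / ε) / q := by field_simp
      _ ≤ X / q := by
          gcongr
          exact le_max_right _ _
      _ < T * (c / q) := by
          rw [mul_div_assoc']
          gcongr
          rwa [← div_lt_iff₀ hc]

theorem exists_hasLinearComplexity_of_isDiagonalizedBy {Φ : Point n m → Point n m}
    {run : Point n m → ℕ → RunState n m} {zs : Point n m} {U : Set (Point n m)}
    {M : Matrix (Fin n ⊕ Fin m) (Fin n ⊕ Fin m) ℝ} {P : Matrix (Fin n ⊕ Fin m) (Fin n ⊕ Fin m) ℂ}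
    {θ : Fin n ⊕ Fin m → ℂ} {a : ℕ} {c c' K q : ℝ} (hfix : Φ zs = zs)
    (hΦ : HasFDerivAt Φ (toEuclideanCLM (𝕜 := ℝ) M) zs) (hM : IsDiagonalizedBy M P θ)
    (hθ : ∀ i, ‖θ i‖ ≤ 1 - c' / q) (hc : 0 < c) (hcc' : c < c') (hcq : c' ≤ q)
    (hK : a * (1 / c + 1) ≤ K) (hU : U ∈ 𝓝 zs) (hpoint : ∀ z T, (run z T).point = Φ^[T] z)
    (hcalls : ∀ z T, (run z T).calls = a * T) :
    ∃ δ > 0, ∀ z₀, ‖z₀ - zs‖ ≤ δ → (∀ T, (run z₀ T).point ∈ U) ∧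
      HasLinearComplexity (run z₀) zs (‖P‖ * ‖P⁻¹‖ * ‖z₀ - zs‖) c K q := by
  have hq : 0 < q := hc.trans (hcc'.trans_le hcq)
  have hrate : 1 - c' / q < 1 - c / q := by gcongr
  have hρ₀ : 0 ≤ 1 - c' / q := sub_nonneg.2 ((div_le_one hq).2 hcq)
  have hρ : 1 - c / q ≤ 1 := sub_le_self _ (by positivity)
  obtain ⟨δ, hδ, H⟩ := exists_iterate_norm_le_of_isDiagonalizedBy hfix hΦ hM hρ₀ hθ hrate hρ hU
  simp only [← hpoint] at H
  exact ⟨δ, hδ, fun z₀ hz₀ => ⟨fun T => (H z₀ hz₀ T).1,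
    hasLinearComplexity_of_norm_le hc (hcc'.le.trans hcq) hK (hcalls z₀)
      fun T => (H z₀ hz₀ T).2⟩⟩

end Complexity

section Multipliers

theorem norm_one_add_le {s : ℂ} (hre : -(1 / 4) ≤ s.re) (him : s.im ^ 2 ≤ -s.re / 2) :
    ‖1 + s‖ ≤ 1 + s.re / 2 := by
  refine le_of_sq_le_sq ?_ (by linarith)
  rw [← Complex.normSq_eq_norm_sq, Complex.normSq_apply]
  simp only [Complex.add_re, Complex.one_re, Complex.add_im, Complex.one_im]
  nlinarith

theorem norm_one_add_mul_one_add_le {s : ℂ} (hre : -(1 / 4) ≤ s.re)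
    (him : s.im ^ 2 ≤ -s.re / 2) : ‖1 + s * (1 + s)‖ ≤ 1 + s.re / 2 := by
  have : s.re ≤ 0 := by nlinarith
  have hreal : (1 + s.re + s.re ^ 2) ^ 2 ≤ (1 + s.re / 2) ^ 2 := by
    apply pow_le_pow_left₀ <;> nlinarith
  have himag : 0 ≤ s.im ^ 2 * (1 - 2 * s.re - 2 * s.re ^ 2 - s.im ^ 2) :=
    mul_nonneg (sq_nonneg _) (by nlinarith)
  refine le_of_sq_le_sq ?_ (by linarith)
  calc ‖1 + s * (1 + s)‖ ^ 2
      = (1 + s.re + s.re ^ 2) ^ 2 - s.im ^ 2 * (1 - 2 * s.re - 2 * s.re ^ 2 - s.im ^ 2) := by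
        rw [← Complex.normSq_eq_norm_sq, Complex.normSq_apply]
        simp only [Complex.add_re, Complex.one_re, Complex.add_im, Complex.one_im, Complex.mul_re,
          Complex.mul_im]
        ring
    _ ≤ (1 + s.re / 2) ^ 2 := by linarith

theorem norm_multipliers_le {a η x : ℝ} {l : ℂ} (hη : 0 < η) (hηa : η * a = 1 / 4)
    (hx : l.re ≤ -x) (hre : -a ≤ l.re) (him : l.im ^ 2 ≤ 2 * a * -l.re) :
    ‖1 + (η : ℂ) * l‖ ≤ 1 - η * x / 2 ∧
      ‖1 + (η : ℂ) * l * (1 + (η : ℂ) * l)‖ ≤ 1 - η * x / 2 := by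
  have hsre : ((η : ℂ) * l).re = η * l.re := Complex.re_ofReal_mul η l
  have hre' : -(1 / 4) ≤ ((η : ℂ) * l).re := by
    rw [hsre, ← hηa, ← mul_neg]
    gcongr
  have him' : ((η : ℂ) * l).im ^ 2 ≤ -((η : ℂ) * l).re / 2 := by
    rw [hsre, Complex.im_ofReal_mul]
    calc (η * l.im) ^ 2 = η ^ 2 * l.im ^ 2 := by ring
      _ ≤ η ^ 2 * (2 * a * -l.re) := by gcongr
      _ = -(η * l.re) / 2 := by linear_combination -2 * η * l.re * hηa
  have hle : 1 + ((η : ℂ) * l).re / 2 ≤ 1 - η * x / 2 := by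
    rw [hsre]
    have := mul_le_mul_of_nonneg_left hx hη.le
    linarith
  exact ⟨(norm_one_add_le hre' him').trans hle, (norm_one_add_mul_one_add_le hre' him').trans hle⟩

end Multipliers

section Gradient

open RealInnerProductSpace

variable {E : Type*} [NormedAddCommGroup E] {f : E → ℝ} {x : E}

theorem eventually_differentiableAt [NormedSpace ℝ E] (hf : ContDiffAt ℝ 2 f x) :
    ∀ᶠ y in 𝓝 x, DifferentiableAt ℝ f y :=
  (hf.eventually (by simp)).mono fun _ hy => hy.differentiableAt two_ne_zero

variable [InnerProductSpace ℝ E] [CompleteSpace E]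

theorem differentiableAt_gradient (hf : ContDiffAt ℝ 2 f x) : DifferentiableAt ℝ (gradient f) x :=
  (InnerProductSpace.toDual ℝ E).symm.toContinuousLinearEquiv.differentiableAt.comp x
    ((hf.fderiv_right (m := 1) (by norm_num)).differentiableAt one_ne_zero)

theorem isSymmetric_fderiv_gradient (hf : ∀ᶠ y in 𝓝 x, DifferentiableAt ℝ f y)
    (hf' : DifferentiableAt ℝ (gradient f) x) :
    (fderiv ℝ (gradient f) x : E →ₗ[ℝ] E).IsSymmetric := by
  intro u v
  have hsymm := second_derivative_symmetric_of_eventually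
    (hf.mono fun _ hy => hy.hasGradientAt.hasFDerivAt)
    ((innerSL ℝ : E →L[ℝ] E →L[ℝ] ℝ).hasFDerivAt.comp x hf'.hasFDerivAt) u v
  exact hsymm.trans (real_inner_comm _ _)

end Gradient

section Hessian

variable {n m : ℕ} {f : Point n m → ℝ} {zs : Point n m}

theorem toEuclideanCLM_hess (f : Point n m → ℝ) (z : Point n m) :
    toEuclideanCLM (𝕜 := ℝ) (hess f z) = fderiv ℝ (gradient f) z := by
  refine ContinuousLinearMap.coe_injective ((EuclideanSpace.basisFun _ ℝ).toBasis.ext fun j => ?_)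
  ext i
  simp [hess, ofLp_toEuclideanCLM]

theorem hasFDerivAt_gradient (hf' : DifferentiableAt ℝ (gradient f) zs) :
    HasFDerivAt (gradient f) (toEuclideanCLM (𝕜 := ℝ) (hess f zs)) zs := by
  rw [toEuclideanCLM_hess]
  exact hf'.hasFDerivAt

theorem isHermitian_hess (hf : ∀ᶠ z in 𝓝 zs, DifferentiableAt ℝ f z)
    (hf' : DifferentiableAt ℝ (gradient f) zs) : (hess f zs).IsHermitian := by
  have hsymm := isSymmetric_fderiv_gradient hf hf'
  rw [← toEuclideanCLM_hess] at hsymm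
  exact isSymmetric_toEuclideanLin_iff.1 hsymm

theorem isHermitian_blockC (h : (hess f zs).IsHermitian) : (blockC f zs).IsHermitian :=
  h.submatrix Sum.inl

theorem hess_eq_fromBlocks (h : (hess f zs).IsHermitian) :
    hess f zs = fromBlocks (blockC f zs) (blockB f zs) (blockB f zs)ᵀ (-blockA f zs) := by
  have h₂₁ : (hess f zs).toBlocks₂₁ = (blockB f zs)ᵀ := by
    ext i j
    exact (h.apply (Sum.inr i) (Sum.inl j)).symm
  rw [← h₂₁, blockA, neg_neg]
  exact (fromBlocks_toBlocks _).symm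

theorem gradient_eq_zero (h : IsDifferentialStackelberg f zs) : gradient f zs = 0 := by
  ext i
  rcases i with i | i
  · exact congrFun (congrArg WithLp.ofLp h.gradX_eq_zero) i
  · exact congrFun (congrArg WithLp.ofLp h.gradY_eq_zero) i

end Hessian

section Steps

variable {n m : ℕ} {f : Point n m → ℝ} {zs : Point n m} {ηx ηy : ℝ}

/-- The linear part of a descent step in `x` and ascent step in `y`: a step maps `z` to
`z + stepMatrix ηx ηy *ᵥ gradient f w`. -/
noncomputable def stepMatrix (ηx ηy : ℝ) : Matrix (Fin n ⊕ Fin m) (Fin n ⊕ Fin m) ℝ :=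
  fromBlocks ((-ηx) • 1) 0 0 (ηy • 1)

theorem stepAlong_eq (f : Point n m → ℝ) (ηx ηy : ℝ) (z w : Point n m) :
    stepAlong f ηx ηy z w
      = z + toEuclideanCLM (𝕜 := ℝ) (stepMatrix ηx ηy) (gradient f w) := by
  ext i
  rcases i with i | i <;>
    simp [stepAlong, stepMatrix, gradX, gradY, ofLp_toEuclideanCLM, fromBlocks_mulVec,
      smul_mulVec, neg_mulVec, sub_eq_add_neg]

theorem stepMatrix_mul_hess (h : (hess f zs).IsHermitian) (η r : ℝ) :
    stepMatrix η (r * η) * hess f zs = η • dynMatrix f zs r := by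
  rw [hess_eq_fromBlocks h, dynMatrix, stepMatrix, fromBlocks_smul, fromBlocks_multiply]
  simp [smul_smul, mul_comm]

/-- One iteration of the extra-gradient method. -/
noncomputable def egStep (f : Point n m → ℝ) (ηx ηy : ℝ) (z : Point n m) : Point n m :=
  stepAlong f ηx ηy z (egHalf f ηx ηy z)

theorem gdaRun_eq (f : Point n m → ℝ) (ηx ηy : ℝ) (z₀ : Point n m) (T : ℕ) :
    gdaRun f ηx ηy z₀ T = ⟨(egHalf f ηx ηy)^[T] z₀, T⟩ := by
  induction T with
  | zero => rfl
  | succ T ih => rw [gdaRun, ih, Function.iterate_succ_apply', egHalf]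

theorem egRun_eq (f : Point n m → ℝ) (ηx ηy : ℝ) (z₀ : Point n m) (T : ℕ) :
    egRun f ηx ηy z₀ T = ⟨(egStep f ηx ηy)^[T] z₀, 2 * T⟩ := by
  induction T with
  | zero => rfl
  | succ T ih => rw [egRun, ih, Function.iterate_succ_apply', egStep, mul_add_one]

theorem egHalf_eq_self (h : gradient f zs = 0) : egHalf f ηx ηy zs = zs := by
  rw [egHalf, stepAlong_eq, h, map_zero, add_zero]

theorem egStep_eq_self (h : gradient f zs = 0) : egStep f ηx ηy zs = zs := by
  rw [egStep, egHalf_eq_self h]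
  exact egHalf_eq_self h

theorem hasFDerivAt_stepAlong {φ : Point n m → Point n m}
    {J : Matrix (Fin n ⊕ Fin m) (Fin n ⊕ Fin m) ℝ} (hf' : DifferentiableAt ℝ (gradient f) zs)
    (h : (hess f zs).IsHermitian) (hφ : HasFDerivAt φ (toEuclideanCLM (𝕜 := ℝ) J) zs)
    (hfix : φ zs = zs) (η r : ℝ) :
    HasFDerivAt (fun z => stepAlong f η (r * η) z (φ z))
      (toEuclideanCLM (𝕜 := ℝ) (1 + (η • dynMatrix f zs r) * J)) zs := by
  have hgrad : HasFDerivAt (gradient f) (toEuclideanCLM (𝕜 := ℝ) (hess f zs)) (φ zs) := by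
    rw [hfix]
    exact hasFDerivAt_gradient hf'
  simp only [stepAlong_eq]
  rw [← stepMatrix_mul_hess h, mul_assoc, map_add, map_one, map_mul, map_mul]
  exact (hasFDerivAt_id zs).add ((ContinuousLinearMap.hasFDerivAt _).comp zs (hgrad.comp zs hφ))

theorem hasFDerivAt_egHalf (hf' : DifferentiableAt ℝ (gradient f) zs)
    (h : (hess f zs).IsHermitian) (η r : ℝ) :
    HasFDerivAt (egHalf f η (r * η))
      (toEuclideanCLM (𝕜 := ℝ) (1 + η • dynMatrix f zs r)) zs := by
  have hid : HasFDerivAt id (toEuclideanCLM (𝕜 := ℝ) (1 : Matrix (Fin n ⊕ Fin m) _ ℝ)) zs := by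
    rw [map_one]
    exact hasFDerivAt_id zs
  rw [← mul_one (η • dynMatrix f zs r)]
  exact hasFDerivAt_stepAlong hf' h hid rfl η r

theorem hasFDerivAt_egStep (hf' : DifferentiableAt ℝ (gradient f) zs)
    (h : (hess f zs).IsHermitian) (hgrad : gradient f zs = 0) (η r : ℝ) :
    HasFDerivAt (egStep f η (r * η)) (toEuclideanCLM (𝕜 := ℝ)
      (1 + (η • dynMatrix f zs r) * (1 + η • dynMatrix f zs r))) zs :=
  hasFDerivAt_stepAlong hf' h (hasFDerivAt_egHalf hf' h η r) (egHalf_eq_self hgrad) η r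

end Steps

section Stackelberg

variable {n m : ℕ} {f : Point n m → ℝ} {zs : Point n m} {L μ μx r : ℝ}

theorem IsStackelbergWith.saddleForm (hS : IsStackelbergWith f zs L μ μx)
    (h : (hess f zs).IsHermitian) :
    SaddleForm (toEuclideanLin ((blockC f zs).map Complex.ofReal))
      (toEuclideanLin ((blockB f zs).map Complex.ofReal))
      (toEuclideanLin ((blockB f zs)ᵀ.map Complex.ofReal))
      (toEuclideanLin ((blockA f zs).map Complex.ofReal)) L μ μx := by
  obtain ⟨hst, hsm, hμ, l, hl, rfl⟩ := hS
  obtain ⟨hA, hB, hC⟩ := by simpa only [max_le_iff] using hsm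
  exact saddleForm_of_matrix (isHermitian_blockC h) hst.posDef_A hst.posDef_schur hC hB hA hμ hl

variable {P : Matrix (Fin n ⊕ Fin m) (Fin n ⊕ Fin m) ℂ} {Λ : Fin n ⊕ Fin m → ℂ}

theorem IsStackelbergWith.norm_step_eigenvalues_le (hS : IsStackelbergWith f zs L μ μx)
    (h : (hess f zs).IsHermitian) (hr : 2 * (L / μ) ≤ r)
    (hM : IsDiagonalizedBy (dynMatrix f zs r) P Λ) (i : Fin n ⊕ Fin m) :
    ‖1 + ((1 / (4 * r * L) : ℝ) : ℂ) * Λ i‖ ≤ 1 - 1 / 16 / (r * (L / μx)) ∧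
      ‖1 + ((1 / (4 * r * L) : ℝ) : ℂ) * Λ i * (1 + ((1 / (4 * r * L) : ℝ) : ℂ) * Λ i)‖
        ≤ 1 - 1 / 16 / (r * (L / μx)) := by
  have S := hS.saddleForm h
  have hrμ : 2 * L ≤ r * μ := by rwa [← mul_div_assoc, div_le_iff₀ S.mu_pos] at hr
  have hr0 : 0 < r := zero_lt_one.trans_le (S.one_le_ratio hrμ)
  have hL : 0 < L := S.mu_pos.trans_le S.mu_le
  have hμx : 0 < μx := S.mux_pos
  obtain ⟨v, hv, hMv⟩ := hM.exists_eigenvector i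
  obtain ⟨hx, hre, him⟩ := S.eigenvalue_bounds hrμ (isFlowEigenvector_of_fromBlocks hv hMv)
  have hrate : 1 / 16 / (r * (L / μx)) = 1 / (4 * r * L) * (μx / 2) / 2 := by
    field_simp
    norm_num
  rw [hrate]
  exact norm_multipliers_le (a := r * L) (by positivity) (by field_simp) hx hre
    (by rwa [← mul_assoc])

theorem IsStackelbergWith.one_le_rate (hS : IsStackelbergWith f zs L μ μx)
    (h : (hess f zs).IsHermitian) (hr : 2 * (L / μ) ≤ r) : 1 ≤ r * (L / μx) := by
  have S := hS.saddleForm h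
  have hκ : 1 ≤ L / μ := (one_le_div S.mu_pos).2 S.mu_le
  exact one_le_mul_of_one_le_of_one_le (by linarith) ((one_le_div S.mux_pos).2 S.mux_le)

end Stackelberg

end Minimax

open Minimax in
theorem theorem2_general (n m : ℕ) (D : Set (Point n m)) (f : Point n m → ℝ) (zs : Point n m)
    (L μ μx r : ℝ) (hD : D ∈ 𝓝 zs) (hf : ∀ᶠ z in 𝓝 zs, DifferentiableAt ℝ f z)
    (hf' : DifferentiableAt ℝ (gradient f) zs) (hS : IsStackelbergWith f zs L μ μx)
    (hr : 2 * (L / μ) ≤ r) (ηx ηy : ℝ) (hηx : ηx = 1 / (4 * r * L)) (hηy : ηy = 1 / (4 * L))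
    (P : Matrix (Fin n ⊕ Fin m) (Fin n ⊕ Fin m) ℂ) (Λ : Fin n ⊕ Fin m → ℂ)
    (hP : IsUnit P) (hΛ : (dynMatrix f zs r).map Complex.ofReal = P⁻¹ * Matrix.diagonal Λ * P) :
    ∃ δ > 0, ∀ z₀, ‖z₀ - zs‖ ≤ δ →
      ((∀ T, (gdaRun f ηx ηy z₀ T).point ∈ interior D) ∧
        HasLinearComplexity (gdaRun f ηx ηy z₀) zs (‖P‖ * ‖P⁻¹‖ * ‖z₀ - zs‖) (1 / 32) 66
          (r * (L / μx))) ∧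
      ((∀ T, (egRun f ηx ηy z₀ T).point ∈ interior D ∧
          egHalf f ηx ηy (egRun f ηx ηy z₀ T).point ∈ interior D) ∧
        HasLinearComplexity (egRun f ηx ηy z₀) zs (‖P‖ * ‖P⁻¹‖ * ‖z₀ - zs‖) (1 / 32) 66
          (r * (L / μx))) := by
  have hH := isHermitian_hess hf hf'
  have hgrad := gradient_eq_zero hS.stackelberg
  have hM := IsDiagonalizedBy.of_eq_conj hP hΛ
  have hq := hS.one_le_rate hH hr
  have hθ := hS.norm_step_eigenvalues_le hH hr hM
  rw [← hηx] at hθ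
  have hη : ηy = r * ηx := by
    have hr0 : r ≠ 0 := by rintro rfl; linarith
    rw [hηx, hηy]
    field_simp
  subst hη
  have hhalf := hasFDerivAt_egHalf hf' hH ηx r
  have hU : interior D ∈ 𝓝 zs := interior_mem_nhds.2 hD
  have hU' : interior D ∩ egHalf f ηx (r * ηx) ⁻¹' interior D ∈ 𝓝 zs :=
    Filter.inter_mem hU (hhalf.continuousAt.preimage_mem_nhds (by rwa [egHalf_eq_self hgrad]))
  obtain ⟨δ₁, hδ₁, H₁⟩ := exists_hasLinearComplexity_of_isDiagonalizedBy (a := 1)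
    (run := gdaRun f ηx (r * ηx)) (c := 1 / 32) (K := 66) (egHalf_eq_self hgrad) hhalf
    (hM.smul ηx).one_add (fun i => (hθ i).1) (by norm_num) (by norm_num) (by linarith)
    (by norm_num) hU (by simp [gdaRun_eq]) (by simp [gdaRun_eq])
  obtain ⟨δ₂, hδ₂, H₂⟩ := exists_hasLinearComplexity_of_isDiagonalizedBy (a := 2)
    (run := egRun f ηx (r * ηx)) (c := 1 / 32) (K := 66) (egStep_eq_self hgrad)
    (hasFDerivAt_egStep hf' hH hgrad ηx r) ((hM.smul ηx).mul (hM.smul ηx).one_add).one_add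
    (fun i => (hθ i).2) (by norm_num) (by norm_num) (by linarith) (by norm_num) hU'
    (by simp [egRun_eq]) (by simp [egRun_eq])
  exact ⟨min δ₁ δ₂, lt_min hδ₁ hδ₂, fun z₀ hz₀ =>
    ⟨H₁ z₀ (hz₀.trans (min_le_left _ _)), H₂ z₀ (hz₀.trans (min_le_right _ _))⟩⟩

/-- `c₀` and `K` are numerical constants. `D` is the domain of `f`, a neighbourhood of `zs`;
`P` is a complex matrix that diagonalizes `M`, and `CP` is its condition number. The iterates, and
all points where the gradient is queried, stay in the interior of `D`. -/
theorem theorem2 :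
    ∃ c₀ K : ℝ, 0 < c₀ ∧ c₀ < 1 ∧ 0 < K ∧
      ∀ (n m : ℕ) (D : Set (Minimax.Point n m)) (f : Minimax.Point n m → ℝ)
        (zs : Minimax.Point n m) (L μ μx r κ κx ηx ηy : ℝ),
        D ∈ 𝓝 zs →
        ContDiffOn ℝ 2 f D →
        Minimax.IsStackelbergWith f zs L μ μx →
        κ = L / μ → κx = L / μx →
        2 * κ ≤ r →
        ηx = 1 / (4 * r * L) → ηy = 1 / (4 * L) →
        ∀ (P : Matrix (Fin n ⊕ Fin m) (Fin n ⊕ Fin m) ℂ) (Λ : Fin n ⊕ Fin m → ℂ) (CP : ℝ),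
          IsUnit P →
          (Minimax.dynMatrix f zs r).map Complex.ofReal = P⁻¹ * Matrix.diagonal Λ * P →
          CP = ‖P‖ * ‖P⁻¹‖ →
          ∃ δ : ℝ, 0 < δ ∧ ∀ z₀ : Minimax.Point n m, ‖z₀ - zs‖ ≤ δ →
            ((∀ T : ℕ, (Minimax.gdaRun f ηx ηy z₀ T).point ∈ interior D) ∧
              (∀ T : ℕ,
                ‖(Minimax.gdaRun f ηx ηy z₀ T).point - zs‖
                  ≤ CP * ‖z₀ - zs‖ * (1 - c₀ / (r * κx)) ^ T) ∧
              (∀ ε : ℝ, 0 < ε → ∃ T : ℕ,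
                ((Minimax.gdaRun f ηx ηy z₀ T).calls : ℝ)
                    ≤ K * max 1 (r * κx * Real.log (CP * ‖z₀ - zs‖ / ε)) ∧
                ∀ T' : ℕ, T ≤ T' → ‖(Minimax.gdaRun f ηx ηy z₀ T').point - zs‖ < ε)) ∧
            ((∀ T : ℕ, (Minimax.egRun f ηx ηy z₀ T).point ∈ interior D ∧
                Minimax.egHalf f ηx ηy (Minimax.egRun f ηx ηy z₀ T).point ∈ interior D) ∧
              (∀ T : ℕ,
                ‖(Minimax.egRun f ηx ηy z₀ T).point - zs‖
                  ≤ CP * ‖z₀ - zs‖ * (1 - c₀ / (r * κx)) ^ T) ∧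
              (∀ ε : ℝ, 0 < ε → ∃ T : ℕ,
                ((Minimax.egRun f ηx ηy z₀ T).calls : ℝ)
                    ≤ K * max 1 (r * κx * Real.log (CP * ‖z₀ - zs‖ / ε)) ∧
                ∀ T' : ℕ, T ≤ T' → ‖(Minimax.egRun f ηx ηy z₀ T').point - zs‖ < ε)) := by
  refine ⟨1 / 32, 66, by norm_num, by norm_num, by norm_num, ?_⟩
  rintro n m D f zs L μ μx r _ _ ηx ηy hD hf hS rfl rfl hr hηx hηy P Λ _ hP hΛ rfl
  have hf2 : ContDiffAt ℝ 2 f zs := hf.contDiffAt hD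
  exact theorem2_general n m D f zs L μ μx r hD (Minimax.eventually_differentiableAt hf2)
    (Minimax.differentiableAt_gradient hf2) hS hr ηx ηy hηx hηy P Λ hP hΛ
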